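/- For integers $n\ge 1$, $p,q\ge 0$, put $d=p+q$ and $I_{p,q}=\mathrm{diag}(1,\dots,1,-1,\dots,-1)$ ($p$ ones, $q$ minus ones). Let $\mathbb{O}_d$ be the group of orthogonal $d\times d$ matrices, and let $\|M\|_{2,\infty}$ be the largest Euclidean norm of a row of $M$. For reals $\kappa_\star$ and $\lambda_\star>0$ let $\mathcal{P}_n(\kappa_\star,\lambda_\star,p,q)$ be the set of pairs $(U,\Lambda)$ such that $U\in\mathbb{R}^{n\times d}$ satisfies $U^TU=I_d$; $\Lambda=\mathrm{diag}(\lambda_1,\dots,\lambda_d)$ with $\lambda_1\ge\dots\ge\lambda_d\ge\lambda_\star$ and $\lambda_1/\lambda_d\le\kappa_\star$; and all entries of $P=U\Lambda^{1/2}I_{p,q}\Lambda^{1/2}U^T$ lie in $[0,1]$. Given such a pair, let $A\in\{0,1\}^{n\times n}$ be the symmetric adjacency matrix with zero diagonal whose entries $A_{ij}$, $i<j$, are independent with $A_{ij}\sim\mathrm{Bern}(P_{ij})$; $\mathbb{E}$ is the expectation under this law. An estimator is a function $\hat U=\hat U(A)\in\mathbb{R}^{n\times d}$. There is an absolute constant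 $c>0$ such that the following holds. Let $p=p_n\ge 1$, $q=q_n\ge 0$, $\kappa_\star=\kappa_{\star,n}$ and $\lambda_\star=\lambda_{\star,n}>0$ be sequences with $d=d_n=p_n+q_n\ge 2$, $\kappa_\star=o(n)$, $\kappa_\star\ge 3d$ and $3\kappa_\star\lambda_\star\le n$ for all large $n$. Then for all sufficiently large $n$, $$\inf_{\hat U}\ \sup_{(U,\Lambda)\in\mathcal{P}_n(\kappa_\star,\lambda_\star,p,q)}\ \mathbb{E}\min_{W\in\mathbb{O}_d}\big\|\hat U-UW\big\|_{2,\infty}\ \ge\ c\,\sqrt{\frac{\kappa_\star\,(\lambda_\star\wedge\log n)}{\lambda_\star\, n}}.$$ -/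

import Mathlib

open Filter Asymptotics MeasureTheory Matrix
open scoped ENNReal Topology

noncomputable section

namespace LowRankNetwork

/-- The signature matrix `I_{p,q} = diag(1, …, 1, -1, …, -1)` with `p` ones and `q` minus ones. -/
def signature (p q : ℕ) : Matrix (Fin (p + q)) (Fin (p + q)) ℝ :=
  Matrix.diagonal fun k => if (k : ℕ) < p then 1 else -1

/-- The matrix `X I_{p,q} Xᵀ` of indefinite inner products of the rows of `X`. -/
def gram {n p q : ℕ} (X : Matrix (Fin n) (Fin (p + q)) ℝ) : Matrix (Fin n) (Fin n) ℝ :=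
  X * signature p q * Xᵀ

/-- The collections of `n` latent positions whose indefinite inner products are probabilities. -/
def latentSet (n p q : ℕ) : Set (Matrix (Fin n) (Fin (p + q)) ℝ) :=
  {X | ∀ i j, 0 ≤ gram X i j ∧ gram X i j ≤ 1}

/-- The Stiefel manifold of `n × d` matrices with orthonormal columns. -/
def stiefel (n d : ℕ) : Set (Matrix (Fin n) (Fin d) ℝ) :=
  {U | Uᵀ * U = 1}

/-- The diagonals `(l 0 ≥ l 1 ≥ ⋯ ≥ l (d - 1))` with smallest entry at least `lamStar`, and with
condition number, i.e. largest ratio of two entries, at most `kappaStar`. -/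
def spectrumSet (d : ℕ) (kappaStar lamStar : ℝ) : Set (Fin d → ℝ) :=
  {l | Antitone l ∧ (∀ i j, l i / l j ≤ kappaStar) ∧ (∀ i, lamStar ≤ l i) ∧ 0 < lamStar}

/-- The latent position matrix `U Λ^{1/2}`, where `Λ = diag l`. -/
def latent {n d : ℕ} (U : Matrix (Fin n) (Fin d) ℝ) (l : Fin d → ℝ) :
    Matrix (Fin n) (Fin d) ℝ :=
  U * Matrix.diagonal fun k => √(l k)

/-- The parameter set: pairs `(U, Λ)`, with `Λ` given by its diagonal, such that `U` has
orthonormal columns, `Λ` has the prescribed spectral structure, and `U Λ^{1/2}` is a valid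
collection of latent positions. -/
def paramSet (n p q : ℕ) (kappaStar lamStar : ℝ) :
    Set (Matrix (Fin n) (Fin (p + q)) ℝ × (Fin (p + q) → ℝ)) :=
  {θ | θ.1 ∈ stiefel n (p + q) ∧ θ.2 ∈ spectrumSet (p + q) kappaStar lamStar ∧
    latent θ.1 θ.2 ∈ latentSet n p q}

/-- The Bernoulli distribution on `{true, false}` with success probability `r`; the projection to
`[0, 1]` changes nothing for `0 ≤ r ≤ 1`, the only case that occurs. -/
def bern (r : ℝ) : Measure Bool :=
  ProbabilityTheory.bernoulliMeasure true false (Set.projIcc (0 : ℝ) 1 zero_le_one r)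

/-- The pairs of nodes `i < j`. -/
abbrev Pairs (n : ℕ) : Type := {e : Fin n × Fin n // e.1 < e.2}

/-- The law of the edge indicators: independent over all `i < j`, with parameters `P i j`. -/
def edgeLaw {n : ℕ} (P : Matrix (Fin n) (Fin n) ℝ) : Measure (Pairs n → Bool) :=
  Measure.pi fun e => bern (P e.1.1 e.1.2)

/-- The symmetric binary adjacency matrix, with zero diagonal, of a family of edge indicators. -/
def adjacency {n : ℕ} (ω : Pairs n → Bool) : Matrix (Fin n) (Fin n) ℝ := fun i j =>
  if h : i < j then (if ω ⟨(i, j), h⟩ then 1 else 0)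
  else if h : j < i then (if ω ⟨(j, i), h⟩ then 1 else 0)
  else 0

/-- The two-to-infinity norm: the largest Euclidean norm of a row. -/
def twoInftyNorm {n d : ℕ} (M : Matrix (Fin n) (Fin d) ℝ) : ℝ :=
  ⨆ i, ‖WithLp.toLp 2 (M i)‖

/-- The distance modulo rotation: the minimum of `‖V - U W‖_{2,∞}` over all orthogonal `W`. -/
def subspaceLoss {n d : ℕ} (V U : Matrix (Fin n) (Fin d) ℝ) : ℝ :=
  ⨅ W : Matrix.orthogonalGroup (Fin d) ℝ,
    twoInftyNorm (V - U * (W : Matrix (Fin d) (Fin d) ℝ))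

/-- The expected loss of the estimator `est`, a function of the adjacency matrix, when the network
has expectation `U Λ^{1/2} I_{p,q} Λ^{1/2} Uᵀ`. -/
def subspaceRisk {n p q : ℕ}
    (est : Matrix (Fin n) (Fin n) ℝ → Matrix (Fin n) (Fin (p + q)) ℝ)
    (U : Matrix (Fin n) (Fin (p + q)) ℝ) (l : Fin (p + q) → ℝ) : ℝ≥0∞ :=
  ∫⁻ ω, ENNReal.ofReal (subspaceLoss (est (adjacency ω)) U) ∂(edgeLaw (gram (latent U l)))

/-- The minimax risk of singular subspace estimation: the infimum over all estimators, which are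
arbitrary functions since there are only finitely many networks, of the supremum of the risk. -/
def subspaceMinimaxRisk (n p q : ℕ) (kappaStar lamStar : ℝ) : ℝ≥0∞ :=
  ⨅ est : Matrix (Fin n) (Fin n) ℝ → Matrix (Fin n) (Fin (p + q)) ℝ,
    ⨆ θ ∈ paramSet n p q kappaStar lamStar, subspaceRisk est θ.1 θ.2

end LowRankNetwork

end

/-! The bound hides one localized spike among about `n/4` places. All hypotheses have singular
values `(κλ, λ, …, λ)` and a constant first singular vector, so each edge probability is `κλ/n` up
to a constant factor, provided the squared entries of the other columns are at most `3κ/(4n)`. They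
differ only in which pair of rows of the second column is raised from `±b` to `±(b + s)`.

Each mean is within squared Frobenius distance `8λ²s²` of a common reference, so the likelihood
ratio has second moment at most `exp(Cλs²n/κ)` (`sum_edgeMass_sq_div_le`). This is at most `√n` when
`s² ≤ κ log n / (400λn)`, too little to tell the hypotheses apart (`exists_risk_ge`). The reference
need not lie in the parameter set: for `s > 0` its second column is shorter than a unit vector.

Rotations preserve row norms, so the spiked row alone separates two hypotheses by `s/2` for every
`W`. Keeping the probabilities valid also asks for `s²` of order at most `κ/n`, whence the minimum
of `λ` and `log n`. The condition `κ ≥ 3d` leaves room for disjoint supports of the remaining `d -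
2` columns. -/

noncomputable section

namespace LowRankNetwork

/-! ### Testing many hypotheses by second moments -/

/-- If the likelihood ratios of finitely many hypotheses to a reference law have second moments
at most `V`, disjoint acceptance regions have total probability at most `√(V M)`. -/
lemma sum_acceptance_le {Ω ι : Type*} [Fintype Ω] [Fintype ι] [DecidableEq Ω]
    (f₀ : Ω → ℝ) (hf₀ : ∀ ω, 0 < f₀ ω) (hf₀1 : ∑ ω, f₀ ω = 1) (f : ι → Ω → ℝ) (V : ℝ)
    (hV : ∀ a, ∑ ω, f a ω ^ 2 / f₀ ω ≤ V) (E : ι → Finset Ω)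
    (hE : ∀ a b, a ≠ b → Disjoint (E a) (E b)) :
    (∑ a, ∑ ω ∈ E a, f a ω) ^ 2 ≤ V * Fintype.card ι := by
  -- Cauchy–Schwarz over the disjoint union of the regions; disjointness bounds the total of `f₀` by
  -- one.
  have hcs := Finset.sum_mul_sq_le_sq_mul_sq (Finset.univ.sigma E)
    (fun x : (_ : ι) × Ω => f x.1 x.2 / √(f₀ x.2)) (fun x => √(f₀ x.2))
  have h1 : ∑ x ∈ Finset.univ.sigma E, f x.1 x.2 / √(f₀ x.2) * √(f₀ x.2)
      = ∑ a, ∑ ω ∈ E a, f a ω := by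
    rw [Finset.sum_sigma]
    refine Finset.sum_congr rfl fun a _ => Finset.sum_congr rfl fun ω _ => ?_
    exact div_mul_cancel₀ _ (Real.sqrt_pos.2 (hf₀ ω)).ne'
  have h2 : ∑ x ∈ Finset.univ.sigma E, (f x.1 x.2 / √(f₀ x.2)) ^ 2
      ≤ V * Fintype.card ι := by
    rw [Finset.sum_sigma]
    calc _ ≤ ∑ _a : ι, V := Finset.sum_le_sum fun a _ => ?_
      _ = V * Fintype.card ι := by simp [mul_comm]
    refine le_trans ?_ (hV a)
    calc _ = ∑ ω ∈ E a, f a ω ^ 2 / f₀ ω :=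
          Finset.sum_congr rfl fun ω _ => by rw [div_pow, Real.sq_sqrt (hf₀ ω).le]
      _ ≤ _ := Finset.sum_le_univ_sum_of_nonneg fun ω => div_nonneg (sq_nonneg _) (hf₀ ω).le
  have h3 : ∑ x ∈ Finset.univ.sigma E, √(f₀ x.2) ^ 2 ≤ 1 := by
    rw [Finset.sum_sigma]
    calc _ = ∑ a, ∑ ω ∈ E a, f₀ ω := Finset.sum_congr rfl fun a _ =>
          Finset.sum_congr rfl fun ω _ => Real.sq_sqrt (hf₀ ω).le
      _ = ∑ ω ∈ Finset.univ.biUnion E, f₀ ω :=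
          (Finset.sum_biUnion fun a _ b _ hab => hE a b hab).symm
      _ ≤ ∑ ω, f₀ ω := Finset.sum_le_univ_sum_of_nonneg fun ω => (hf₀ ω).le
      _ = 1 := hf₀1
  rw [h1] at hcs
  have h4 : 0 ≤ ∑ x ∈ Finset.univ.sigma E, (f x.1 x.2 / √(f₀ x.2)) ^ 2 :=
    Finset.sum_nonneg fun _ _ => sq_nonneg _
  nlinarith

/-- A lower bound for the maximal risk over finitely many separated hypotheses. -/
lemma exists_risk_ge {Ω ι : Type*} [Fintype Ω] [Fintype ι] [Nonempty ι]
    (f₀ : Ω → ℝ) (hf₀ : ∀ ω, 0 < f₀ ω) (hf₀1 : ∑ ω, f₀ ω = 1) (f : ι → Ω → ℝ)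
    (hf : ∀ a ω, 0 ≤ f a ω) (hf1 : ∀ a, ∑ ω, f a ω = 1) (V : ℝ)
    (hV : ∀ a, ∑ ω, f a ω ^ 2 / f₀ ω ≤ V) (hVM : 4 * V ≤ Fintype.card ι)
    (loss : ι → Ω → ℝ) (hloss : ∀ a ω, 0 ≤ loss a ω) (r : ℝ) (hr : 0 ≤ r)
    (hsep : ∀ a b, a ≠ b → ∀ ω, 2 * r ≤ loss a ω + loss b ω) :
    ∃ a, r / 2 ≤ ∑ ω, f a ω * loss a ω := by
  classical
  set E : ι → Finset Ω := fun a => Finset.univ.filter fun ω => loss a ω < r with hEdef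
  have hE : ∀ a b, a ≠ b → Disjoint (E a) (E b) := by
    intro a b hab
    rw [Finset.disjoint_left]
    intro ω ha hb
    simp only [hEdef, Finset.mem_filter, Finset.mem_univ, true_and] at ha hb
    linarith [hsep a b hab ω]
  have hacc := sum_acceptance_le f₀ hf₀ hf₀1 f V hV E hE
  have hM : (0 : ℝ) < Fintype.card ι := by exact_mod_cast Fintype.card_pos
  -- Since `4V ≤ M`, the total is at most `√(VM) ≤ M/2`: acceptance has probability at most one half
  -- on average, and Markov's inequality gives `r / 2`.
  have hhalf : ∑ a, ∑ ω ∈ E a, f a ω ≤ (Fintype.card ι : ℝ) / 2 := by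
    refine (abs_le_of_sq_le_sq' ?_ (by positivity)).2
    nlinarith
  have hrisk : ∀ a, r * (1 - ∑ ω ∈ E a, f a ω) ≤ ∑ ω, f a ω * loss a ω := by
    intro a
    have hc : 1 - ∑ ω ∈ E a, f a ω = ∑ ω ∈ (E a)ᶜ, f a ω := by
      rw [← hf1 a, ← Finset.sum_add_sum_compl (E a)]; ring
    rw [hc, Finset.mul_sum]
    refine (Finset.sum_le_sum fun ω hω => ?_).trans
      (Finset.sum_le_univ_sum_of_nonneg fun ω => mul_nonneg (hf a ω) (hloss a ω))
    simp only [hEdef, Finset.compl_filter, Finset.mem_filter, Finset.mem_univ, true_and,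
      not_lt] at hω
    rw [mul_comm]
    exact mul_le_mul_of_nonneg_left hω (hf a ω)
  by_contra! hcon
  have h1 : ∑ a, r * (1 - ∑ ω ∈ E a, f a ω) < ∑ _a : ι, r / 2 :=
    Finset.sum_lt_sum_of_nonempty Finset.univ_nonempty fun a _ => (hrisk a).trans_lt (hcon a)
  rw [← Finset.mul_sum, Finset.sum_sub_distrib] at h1
  simp only [Finset.sum_const, Finset.card_univ, nsmul_eq_mul, mul_one] at h1
  nlinarith

/-! ### The law of the network -/

/-- The probability mass function of `edgeLaw P`. -/
def edgeMass {n : ℕ} (P : Matrix (Fin n) (Fin n) ℝ) (ω : Pairs n → Bool) : ℝ :=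
  ∏ e, if ω e then P e.1.1 e.1.2 else 1 - P e.1.1 e.1.2

lemma sum_prod_bool {ι : Type*} [Fintype ι] [DecidableEq ι] (x y : ι → ℝ) :
    ∑ ω : ι → Bool, ∏ e, (if ω e then x e else y e) = ∏ e, (x e + y e) := by
  have h := (Fintype.prod_sum fun (e : ι) (b : Bool) => if b then x e else y e).symm
  simpa using h

lemma sum_edgeMass {n : ℕ} (P : Matrix (Fin n) (Fin n) ℝ) : ∑ ω, edgeMass P ω = 1 := by
  simp [edgeMass, sum_prod_bool]

lemma edgeMass_nonneg {n : ℕ} {P : Matrix (Fin n) (Fin n) ℝ}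
    (hP : ∀ i j, 0 ≤ P i j ∧ P i j ≤ 1) (ω : Pairs n → Bool) : 0 ≤ edgeMass P ω :=
  Finset.prod_nonneg fun e _ => by
    split_ifs
    · exact (hP _ _).1
    · linarith [(hP e.1.1 e.1.2).2]

lemma edgeMass_pos {n : ℕ} {P : Matrix (Fin n) (Fin n) ℝ}
    (hP : ∀ i j, 0 < P i j ∧ P i j < 1) (ω : Pairs n → Bool) : 0 < edgeMass P ω :=
  Finset.prod_pos fun e _ => by
    split_ifs
    · exact (hP _ _).1
    · linarith [(hP e.1.1 e.1.2).2]

instance (r : ℝ) : IsProbabilityMeasure (bern r) := by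
  unfold bern; infer_instance

lemma bern_singleton {r : ℝ} (h0 : 0 ≤ r) (h1 : r ≤ 1) (b : Bool) :
    bern r {b} = ENNReal.ofReal (if b then r else 1 - r) := by
  have hp : (Set.projIcc (0 : ℝ) 1 zero_le_one r) = ⟨r, h0, h1⟩ :=
    Set.projIcc_of_mem zero_le_one ⟨h0, h1⟩
  unfold bern
  rw [hp, ProbabilityTheory.bernoulliMeasure_apply _ (measurableSet_singleton b)]
  cases b
  · simp only [Set.mem_singleton_iff, Bool.true_eq_false, if_false, if_true, Bool.false_eq_true]
    rw [← ENNReal.ofReal_coe_nnreal]; rfl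
  · simp only [Set.mem_singleton_iff, Bool.false_eq_true, if_false, if_true]
    rw [← ENNReal.ofReal_coe_nnreal]; rfl

lemma lintegral_edgeLaw {n : ℕ} {P : Matrix (Fin n) (Fin n) ℝ}
    (hP : ∀ i j, 0 ≤ P i j ∧ P i j ≤ 1) (g : (Pairs n → Bool) → ℝ) (hg : ∀ ω, 0 ≤ g ω) :
    ∫⁻ ω, ENNReal.ofReal (g ω) ∂(edgeLaw P) = ENNReal.ofReal (∑ ω, edgeMass P ω * g ω) := by
  rw [lintegral_fintype, ENNReal.ofReal_sum_of_nonneg fun ω _ =>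
    mul_nonneg (edgeMass_nonneg hP ω) (hg ω)]
  refine Finset.sum_congr rfl fun ω _ => ?_
  have hmass : edgeLaw P {ω} = ENNReal.ofReal (edgeMass P ω) := by
    rw [edgeLaw, Measure.pi_singleton, edgeMass, ENNReal.ofReal_prod_of_nonneg]
    · exact Finset.prod_congr rfl fun e _ => bern_singleton (hP _ _).1 (hP _ _).2 _
    · intro e _
      split_ifs
      · exact (hP _ _).1
      · linarith [(hP e.1.1 e.1.2).2]
  rw [hmass, ENNReal.ofReal_mul (edgeMass_nonneg hP ω), mul_comm]

/-- The second moment of the likelihood ratio of two networks. -/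
lemma sum_edgeMass_sq_div_le {n : ℕ} (P Q : Matrix (Fin n) (Fin n) ℝ) {lo hi : ℝ} (hlo : 0 < lo)
    (hhi : hi < 1) (hQ : ∀ i j, lo ≤ Q i j ∧ Q i j ≤ hi) :
    ∑ ω, edgeMass P ω ^ 2 / edgeMass Q ω ≤
      Real.exp ((∑ i, ∑ j, (P i j - Q i j) ^ 2) / (lo * (1 - hi))) := by
  have h1 : ∀ ω : Pairs n → Bool, edgeMass P ω ^ 2 / edgeMass Q ω =
      ∏ e, if ω e then P e.1.1 e.1.2 ^ 2 / Q e.1.1 e.1.2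
        else (1 - P e.1.1 e.1.2) ^ 2 / (1 - Q e.1.1 e.1.2) := by
    intro ω
    rw [edgeMass, edgeMass, ← Finset.prod_pow, ← Finset.prod_div_distrib]
    refine Finset.prod_congr rfl fun e _ => ?_
    split_ifs <;> rfl
  simp_rw [h1]
  rw [sum_prod_bool]
  have h2 : ∀ e : Pairs n, P e.1.1 e.1.2 ^ 2 / Q e.1.1 e.1.2
      + (1 - P e.1.1 e.1.2) ^ 2 / (1 - Q e.1.1 e.1.2) ≤
      Real.exp ((P e.1.1 e.1.2 - Q e.1.1 e.1.2) ^ 2 / (lo * (1 - hi))) := by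
    intro e
    obtain ⟨ha, hb⟩ := hQ e.1.1 e.1.2
    generalize Q e.1.1 e.1.2 = y at *
    generalize P e.1.1 e.1.2 = x at *
    have hy : 0 < y := by linarith
    have hy' : 0 < 1 - y := by linarith
    -- One plus the chi-square divergence of two Bernoulli laws.
    have heq : x ^ 2 / y + (1 - x) ^ 2 / (1 - y) = (x - y) ^ 2 / (y * (1 - y)) + 1 := by
      field_simp; ring
    rw [heq]
    refine le_trans ?_ (Real.add_one_le_exp _)
    gcongr
  calc _ ≤ ∏ e : Pairs n, Real.exp ((P e.1.1 e.1.2 - Q e.1.1 e.1.2) ^ 2 / (lo * (1 - hi))) := by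
        refine Finset.prod_le_prod (fun e _ => ?_) fun e _ => h2 e
        obtain ⟨ha, hb⟩ := hQ e.1.1 e.1.2
        exact add_nonneg (div_nonneg (sq_nonneg _) (by linarith))
          (div_nonneg (sq_nonneg _) (by linarith))
    _ = Real.exp ((∑ e : Pairs n, (P e.1.1 e.1.2 - Q e.1.1 e.1.2) ^ 2) / (lo * (1 - hi))) := by
        rw [← Real.exp_sum, Finset.sum_div]
    _ ≤ _ := by
        have hpos : 0 ≤ lo * (1 - hi) := mul_nonneg hlo.le (by linarith)
        gcongr
        rw [← Fintype.sum_prod_type' fun i j => (P i j - Q i j) ^ 2]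
        have hsplit := Fintype.sum_subtype_add_sum_subtype
          (fun e : Fin n × Fin n => e.1 < e.2) fun e => (P e.1 e.2 - Q e.1 e.2) ^ 2
        refine le_trans (le_add_of_nonneg_right ?_) hsplit.le
        exact Finset.sum_nonneg fun e _ => sq_nonneg _

/-! ### Row norms and the loss -/

lemma norm_row_eq {n d : ℕ} (M : Matrix (Fin n) (Fin d) ℝ) (i : Fin n) :
    ‖WithLp.toLp 2 (M i)‖ = √((M * Mᵀ) i i) := by
  rw [EuclideanSpace.norm_eq]
  simp [Matrix.mul_apply, sq]

/-- Row norms are read off `M Mᵀ`, which is unchanged when `M` becomes `M W`. -/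
lemma norm_row_mul_orthogonal {n d : ℕ} (M : Matrix (Fin n) (Fin d) ℝ)
    (W : Matrix.orthogonalGroup (Fin d) ℝ) (i : Fin n) :
    ‖WithLp.toLp 2 ((M * (W : Matrix (Fin d) (Fin d) ℝ)) i)‖ = ‖WithLp.toLp 2 (M i)‖ := by
  have hW : (W : Matrix (Fin d) (Fin d) ℝ) * (W : Matrix (Fin d) (Fin d) ℝ)ᵀ = 1 :=
    (Matrix.mem_orthogonalGroup_iff (Fin d) ℝ).1 W.2
  rw [norm_row_eq, norm_row_eq, Matrix.transpose_mul, Matrix.mul_assoc,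
    ← Matrix.mul_assoc (W : Matrix (Fin d) (Fin d) ℝ), hW, Matrix.one_mul]

/-- Row norms do not depend on the rotation, so their difference is a lower bound for the loss. -/
lemma abs_norm_row_sub_le_subspaceLoss {n d : ℕ} (V U : Matrix (Fin n) (Fin d) ℝ) (i : Fin n) :
    |‖WithLp.toLp 2 (V i)‖ - ‖WithLp.toLp 2 (U i)‖| ≤ subspaceLoss V U := by
  refine le_ciInf fun W => ?_
  rw [← norm_row_mul_orthogonal U W i]
  refine (abs_norm_sub_norm_le _ _).trans ?_
  exact le_ciSup (f := fun i => ‖WithLp.toLp 2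
    ((V - U * (W : Matrix (Fin d) (Fin d) ℝ)) i)‖) (Set.finite_range _).bddAbove i

lemma subspaceLoss_nonneg {n d : ℕ} (V U : Matrix (Fin n) (Fin d) ℝ) : 0 ≤ subspaceLoss V U :=
  Real.iInf_nonneg fun _ => Real.iSup_nonneg fun _ => norm_nonneg _

/-! ### Orthonormal frames built from pairs of rows -/

lemma sum_range_two_mul (g : ℕ → ℝ) (H : ℕ) :
    ∑ i ∈ Finset.range (2 * H), g i = ∑ j ∈ Finset.range H, (g (2 * j) + g (2 * j + 1)) := by
  induction H with
  | zero => simp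
  | succ H ih =>
    rw [Finset.sum_range_succ, ← ih, show 2 * (H + 1) = 2 * H + 1 + 1 by ring,
      Finset.sum_range_succ, Finset.sum_range_succ]
    ring

/-- Summation over consecutive pairs; if `n` is odd, the last summand has to vanish. -/
lemma sum_fin_eq_sum_pairs (g : ℕ → ℝ) (n : ℕ) (hg : ∀ i, i / 2 = n / 2 → g i = 0) :
    ∑ i : Fin n, g i = ∑ j ∈ Finset.range (n / 2), (g (2 * j) + g (2 * j + 1)) := by
  rw [Fin.sum_univ_eq_sum_range, ← sum_range_two_mul]
  rcases Nat.even_or_odd' n with ⟨m, rfl | rfl⟩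
  · rw [Nat.mul_div_cancel_left _ two_pos]
  · rw [show (2 * m + 1) / 2 = m by omega, Finset.sum_range_succ, hg (2 * m) (by omega), add_zero]

/-- A matrix with constant first column. Its rows come in consecutive pairs, and the `j`-th pair has
entries `w j` and `-w j` in column `c j` and vanishes in all others. -/
def frame (n d : ℕ) (c : ℕ → ℕ) (w : ℕ → ℝ) : Matrix (Fin n) (Fin d) ℝ := fun i k =>
  if (k : ℕ) = 0 then 1 / √n
  else if c ((i : ℕ) / 2) = k then (-1) ^ (i : ℕ) * w ((i : ℕ) / 2) else 0

section frame

variable {n d : ℕ} {c : ℕ → ℕ} {w : ℕ → ℝ}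

/-- For odd `n` the unpaired last row has pair index `n / 2`. The condition `d ≤ c (n / 2)` sends it
to a column outside the matrix, so it vanishes off the first column. -/
lemma sum_frame_sq (hc : d ≤ c (n / 2)) (w : ℕ → ℝ) {k : Fin d} (hk : (k : ℕ) ≠ 0) :
    ∑ i, frame n d c w i k ^ 2
      = 2 * ∑ j ∈ Finset.range (n / 2), if c j = k then w j ^ 2 else 0 := by
  have hkd := k.2
  simp only [frame, hk, if_false]
  rw [sum_fin_eq_sum_pairs (fun i => (if c (i / 2) = k then (-1) ^ i * w (i / 2) else 0) ^ 2) n,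
    Finset.mul_sum]
  · refine Finset.sum_congr rfl fun j _ => ?_
    rw [show 2 * j / 2 = j by omega, show (2 * j + 1) / 2 = j by omega,
      (even_two_mul j).neg_one_pow, (odd_two_mul_add_one j).neg_one_pow]
    split_ifs <;> ring
  · intro i hi
    rw [hi, if_neg (by omega)]; simp

lemma sum_frame (hc : d ≤ c (n / 2)) (w : ℕ → ℝ) {k : Fin d} (hk : (k : ℕ) ≠ 0) :
    ∑ i, frame n d c w i k = 0 := by
  have hkd := k.2
  simp only [frame, hk, if_false]
  rw [sum_fin_eq_sum_pairs (fun i => (if c (i / 2) = k then (-1) ^ i * w (i / 2) else 0)) n]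
  · refine Finset.sum_eq_zero fun j _ => ?_
    rw [show 2 * j / 2 = j by omega, show (2 * j + 1) / 2 = j by omega, pow_succ, pow_mul]
    split_ifs <;> simp
  · intro i hi
    rw [hi, if_neg (by omega)]

/-- Opposite signs within a pair give orthogonality to the constant column. Other columns have
disjoint supports, as each pair meets only one of them, so only normalization remains. -/
lemma frame_mem_stiefel (hn : 0 < n) (hc : d ≤ c (n / 2))
    (hw : ∀ k, 1 ≤ k → k < d →
      2 * ∑ j ∈ Finset.range (n / 2), (if c j = k then w j ^ 2 else 0) = 1) :
    frame n d c w ∈ stiefel n d := by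
  have hn' : (0 : ℝ) < n := by exact_mod_cast hn
  have h0 : ∀ k : Fin d, (k : ℕ) = 0 → ∀ i, frame n d c w i k = 1 / √n := fun k hk i => by
    simp [frame, hk]
  change (frame n d c w)ᵀ * frame n d c w = 1
  ext k l
  rw [Matrix.mul_apply]
  simp only [Matrix.transpose_apply]
  by_cases hk : (k : ℕ) = 0
  · simp only [h0 k hk]
    by_cases hl : (l : ℕ) = 0
    · rw [show k = l from Fin.ext (hk.trans hl.symm), Matrix.one_apply_eq]
      simp only [h0 l hl]
      rw [Finset.sum_const, Finset.card_univ, Fintype.card_fin, nsmul_eq_mul, div_mul_div_comm,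
        Real.mul_self_sqrt hn'.le]
      field_simp
    · rw [← Finset.mul_sum, sum_frame hc w hl, mul_zero, Matrix.one_apply_ne]
      rintro rfl; exact hl hk
  · by_cases hl : (l : ℕ) = 0
    · simp only [h0 l hl]
      rw [← Finset.sum_mul, sum_frame hc w hk, zero_mul, Matrix.one_apply_ne]
      rintro rfl; exact hk hl
    · by_cases hkl : k = l
      · subst hkl
        rw [Matrix.one_apply_eq, ← hw k (by omega) k.2, ← sum_frame_sq hc w hk]
        exact Finset.sum_congr rfl fun i _ => (sq _).symm
      · rw [Matrix.one_apply_ne hkl]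
        refine Finset.sum_eq_zero fun i _ => ?_
        have : (k : ℕ) ≠ l := fun h => hkl (Fin.ext h)
        simp only [frame, hk, hl, if_false]
        split_ifs with h1 h2 <;> first | omega | simp

lemma norm_row_frame (hd : 2 ≤ d) {a : ℕ} (hca : c a = 1) (hi : 2 * a < n) :
    ‖WithLp.toLp 2 (frame n d c w ⟨2 * a, hi⟩)‖ = √(1 / n + w a ^ 2) := by
  rw [EuclideanSpace.norm_eq]
  congr 1
  have h : ∀ k : Fin d, ‖frame n d c w ⟨2 * a, hi⟩ k‖ ^ 2
      = (if k = ⟨0, by omega⟩ then 1 / (n : ℝ) else 0)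
        + (if k = ⟨1, by omega⟩ then w a ^ 2 else 0) := by
    intro k
    have h2 : 2 * a / 2 = a := by omega
    simp only [frame, Real.norm_eq_abs, sq_abs, Fin.ext_iff, h2, hca]
    split_ifs with h0 h1 h1 h1 <;> first | omega | skip
    · simp
    · simp [pow_mul]
    · simp
  simp only [h, Finset.sum_add_distrib, Finset.sum_ite_eq', Finset.mem_univ, if_true]

end frame

/-! ### Entries and differences of the means -/

/-- The spectrum `(κ λ, λ, …, λ)`. -/
def spikedSpectrum (d : ℕ) (kap lam : ℝ) : Fin d → ℝ := fun k =>
  if (k : ℕ) = 0 then kap * lam else lam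

lemma spikedSpectrum_mem {d : ℕ} {kap lam : ℝ} (hk : 1 ≤ kap) (hl : 0 < lam) :
    spikedSpectrum d kap lam ∈ spectrumSet d kap lam := by
  have hkl : lam ≤ kap * lam := by nlinarith
  refine ⟨?_, ?_, ?_, hl⟩
  · intro i j hij
    have : (i : ℕ) ≤ j := hij
    simp only [spikedSpectrum]
    split_ifs <;> first | omega | linarith
  · intro i j
    simp only [spikedSpectrum]
    have h1 : 0 < kap * lam := hl.trans_le hkl
    split_ifs
    · rw [div_self h1.ne']; exact hk
    · rw [mul_div_cancel_right₀ _ hl.ne']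
    · rw [div_le_iff₀ h1]; nlinarith
    · rw [div_self hl.ne']; exact hk
  · intro i
    simp only [spikedSpectrum]
    split_ifs
    · exact hkl
    · exact le_rfl

lemma gram_latent {n p q : ℕ} (U : Matrix (Fin n) (Fin (p + q)) ℝ) {l : Fin (p + q) → ℝ}
    (hl : ∀ k, 0 ≤ l k) (i j : Fin n) :
    gram (latent U l) i j =
      ∑ k : Fin (p + q), (if (k : ℕ) < p then 1 else -1) * l k * (U i k * U j k) := by
  rw [gram, latent, signature, Matrix.mul_apply]
  refine Finset.sum_congr rfl fun k _ => ?_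
  rw [Matrix.mul_diagonal, Matrix.mul_diagonal, Matrix.transpose_apply, Matrix.mul_diagonal]
  linear_combination (U i k * U j k * (if (k : ℕ) < p then 1 else -1)) * Real.mul_self_sqrt (hl k)

section gram

variable {n p q : ℕ} {kap lam : ℝ} {c : ℕ → ℕ} {w w' : ℕ → ℝ}

lemma spikedSpectrum_nonneg {d : ℕ} (hk : 0 ≤ kap) (hl : 0 ≤ lam) (k : Fin d) :
    0 ≤ spikedSpectrum d kap lam k := by
  unfold spikedSpectrum
  split_ifs
  · exact mul_nonneg hk hl
  · exact hl

/-- The first column contributes `κ λ / n` to every entry; the others at most `B λ`. -/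
lemma abs_gram_frame_sub_le (hn : 0 < n) (hp : 1 ≤ p) (hk : 0 ≤ kap) (hl : 0 ≤ lam) {B : ℝ}
    (hB : 0 ≤ B) (hw : ∀ j, w j ^ 2 ≤ B) (i j : Fin n) :
    |gram (latent (frame n (p + q) c w) (spikedSpectrum (p + q) kap lam)) i j - kap * lam / n|
      ≤ lam * B := by
  have hn' : (0 : ℝ) < n := by exact_mod_cast hn
  rw [gram_latent _ (spikedSpectrum_nonneg hk hl)]
  set z : Fin (p + q) := ⟨0, by omega⟩ with hz
  rw [← Finset.add_sum_erase _ _ (Finset.mem_univ z)]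
  have h0 : (if (z : ℕ) < p then (1 : ℝ) else -1) * spikedSpectrum (p + q) kap lam z *
      (frame n (p + q) c w i z * frame n (p + q) c w j z) = kap * lam / n := by
    have h1 : 0 < p := hp
    simp only [hz, spikedSpectrum, frame, h1, if_true]
    rw [div_mul_div_comm, Real.mul_self_sqrt hn'.le]
    ring
  rw [h0, add_sub_cancel_left]
  have hww : |w (i / 2) * w (j / 2)| ≤ B := by
    refine abs_le_of_sq_le_sq ?_ hB
    rw [mul_pow, sq B]
    exact mul_le_mul (hw _) (hw _) (sq_nonneg _) hB
  -- Row `i` has at most one nonzero entry beyond the first column, so at most one `k` contributes,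
  -- whatever its sign in the signature.
  have hterm : ∀ k ∈ Finset.univ.erase z, |(if (k : ℕ) < p then (1 : ℝ) else -1) *
      spikedSpectrum (p + q) kap lam k *
      (frame n (p + q) c w i k * frame n (p + q) c w j k)|
      ≤ if (k : ℕ) = c (i / 2) then lam * B else 0 := by
    intro k hkz
    have hk0 : (k : ℕ) ≠ 0 := fun h => (Finset.mem_erase.1 hkz).1 (Fin.ext h)
    have hs : |(if (k : ℕ) < p then (1 : ℝ) else -1)| = 1 := by split_ifs <;> simp
    rw [abs_mul, abs_mul, hs]
    simp only [spikedSpectrum, frame, hk0, if_false, abs_of_nonneg hl, one_mul]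
    by_cases h1 : c (i / 2) = k
    · rw [if_pos h1, if_pos h1.symm]
      refine mul_le_mul_of_nonneg_left ?_ hl
      split_ifs
      · rw [abs_mul, abs_mul, abs_mul, abs_pow, abs_pow, abs_neg, abs_one, one_pow, one_pow,
          one_mul, one_mul, ← abs_mul]
        exact hww
      · simpa using hB
    · rw [if_neg h1, if_neg (Ne.symm h1)]; simp
  refine (Finset.abs_sum_le_sum_abs _ _).trans ((Finset.sum_le_sum hterm).trans ?_)
  rw [← Finset.sum_filter, Finset.sum_const, nsmul_eq_mul]
  have hcard : ((Finset.univ.erase z).filter fun k : Fin (p + q) => (k : ℕ) = c (i / 2)).card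
      ≤ 1 := by
    refine Finset.card_le_one.2 fun x hx y hy => Fin.ext ?_
    rw [(Finset.mem_filter.1 hx).2, (Finset.mem_filter.1 hy).2]
  have hcard' : ((((Finset.univ.erase z).filter
      fun k : Fin (p + q) => (k : ℕ) = c (i / 2)).card : ℕ) : ℝ) ≤ 1 := by exact_mod_cast hcard
  nlinarith [mul_nonneg hl hB]

/-- Split `y i * y j - y' i * y' j` as `(y i - y' i) * y j + y' i * (y j - y' j)`. -/
lemma sum_sq_outer_sub_le {ι : Type*} [Fintype ι] (y y' : ι → ℝ) :
    ∑ i, ∑ j, (y i * y j - y' i * y' j) ^ 2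
      ≤ 2 * (∑ i, (y i - y' i) ^ 2) * (∑ i, y i ^ 2 + ∑ i, y' i ^ 2) := by
  calc _ ≤ ∑ i, ∑ j, (2 * ((y i - y' i) ^ 2 * y j ^ 2) + 2 * (y' i ^ 2 * (y j - y' j) ^ 2)) := by
        refine Finset.sum_le_sum fun i _ => Finset.sum_le_sum fun j _ => ?_
        nlinarith [sq_nonneg ((y i - y' i) * y j - y' i * (y j - y' j))]
    _ = _ := by
        simp only [Finset.sum_add_distrib, ← Finset.mul_sum, ← Finset.sum_mul]
        ring

/-- Two frames that differ only in the second column. -/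
lemma sum_sq_gram_frame_sub_le (hd : 2 ≤ p + q) (hk : 0 ≤ kap) (hl : 0 ≤ lam)
    (hc : p + q ≤ c (n / 2)) (hww : ∀ j, c j ≠ 1 → w j = w' j) :
    ∑ i, ∑ j, (gram (latent (frame n (p + q) c w) (spikedSpectrum (p + q) kap lam)) i j -
        gram (latent (frame n (p + q) c w') (spikedSpectrum (p + q) kap lam)) i j) ^ 2
      ≤ lam ^ 2 * (2 * (2 * ∑ j ∈ Finset.range (n / 2), if c j = 1 then (w j - w' j) ^ 2 else 0) *
        (2 * (∑ j ∈ Finset.range (n / 2), if c j = 1 then w j ^ 2 else 0) +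
          2 * ∑ j ∈ Finset.range (n / 2), if c j = 1 then w' j ^ 2 else 0)) := by
  set o : Fin (p + q) := ⟨1, by omega⟩ with ho
  have ho0 : (o : ℕ) ≠ 0 := one_ne_zero
  have hsub : ∀ i, frame n (p + q) c w i o - frame n (p + q) c w' i o
      = frame n (p + q) c (fun j => w j - w' j) i o := by
    intro i
    simp only [frame, ho0, if_false]
    split_ifs <;> ring
  have h1 := sum_sq_outer_sub_le (fun i => frame n (p + q) c w i o)
    (fun i => frame n (p + q) c w' i o)
  simp only [hsub] at h1
  rw [sum_frame_sq hc _ ho0, sum_frame_sq hc _ ho0, sum_frame_sq hc _ ho0] at h1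
  refine le_trans (le_of_eq ?_) (mul_le_mul_of_nonneg_left h1 (sq_nonneg lam))
  simp only [Finset.mul_sum]
  refine Finset.sum_congr rfl fun i _ => Finset.sum_congr rfl fun j _ => ?_
  -- Only the second column survives the subtraction; squaring removes its sign in the signature.
  rw [gram_latent _ (spikedSpectrum_nonneg hk hl), gram_latent _ (spikedSpectrum_nonneg hk hl),
    ← Finset.sum_sub_distrib, Finset.sum_eq_single o]
  · rw [show spikedSpectrum (p + q) kap lam o = lam from if_neg ho0]
    split_ifs <;> ring
  · intro k _ hko
    have hk1 : (k : ℕ) ≠ 1 := fun h => hko (Fin.ext h)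
    have heq : ∀ i : Fin n, frame n (p + q) c w i k = frame n (p + q) c w' i k := by
      intro i
      simp only [frame]
      split_ifs with h2 h3
      · rfl
      · rw [hww _ (by omega)]
      · rfl
    rw [heq i, heq j, sub_self]
  · simp

end gram

/-! ### Block supports and weights -/

/-- The column of a pair of rows: the first `N` pairs share column `1`, and the following columns
are supported on consecutive blocks of `h` pairs. -/
def blockCol (N h j : ℕ) : ℕ := if j < N then 1 else 2 + (j - N) / h

/-- The entries of `frame` for the hypothesis in which the `a`-th pair is raised by `s`. -/
def spikedWeight (N h : ℕ) (b s : ℝ) (a j : ℕ) : ℝ :=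
  if j < N then (if j = a then b + s else b) else 1 / √(2 * h)

section blocks

variable {N h H d : ℕ} {b s : ℝ} {a : ℕ}

lemma blockCol_eq_one {j : ℕ} : blockCol N h j = 1 ↔ j < N := by
  unfold blockCol
  split_ifs with hj
  · simp [hj]
  · simp only [hj, iff_false]
    generalize (j - N) / h = x
    omega

lemma le_blockCol (hh : 0 < h) (hH : N + h * (d - 2) ≤ H) (hNH : 1 ≤ H - N) : d ≤ blockCol N h H := by
  unfold blockCol
  rw [if_neg (by omega)]
  have : d - 2 ≤ (H - N) / h := by
    rw [Nat.le_div_iff_mul_le hh, mul_comm]; omega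
  omega

lemma sum_blockCol_one (hNH : N ≤ H) (f : ℕ → ℝ) :
    ∑ j ∈ Finset.range H, (if blockCol N h j = 1 then f j else 0) = ∑ j ∈ Finset.range N, f j := by
  simp only [blockCol_eq_one]
  rw [← Finset.sum_filter]
  congr 1
  ext j
  simp only [Finset.mem_filter, Finset.mem_range]
  omega

lemma sum_spike (ha : a < N) (x y : ℝ) :
    ∑ j ∈ Finset.range N, (if j = a then x else y) = (N - 1) * y + x := by
  have h1 : ∀ j ∈ Finset.range N, (if j = a then x else y) = y + if j = a then x - y else 0 := by
    intro j _; split_ifs <;> ring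
  rw [Finset.sum_congr rfl h1, Finset.sum_add_distrib, Finset.sum_ite_eq', if_pos (by simpa using ha)]
  simp; ring

lemma sum_spikedWeight_sq (ha : a < N) :
    ∑ j ∈ Finset.range N, spikedWeight N h b s a j ^ 2 = (N - 1) * b ^ 2 + (b + s) ^ 2 := by
  rw [← sum_spike ha]
  refine Finset.sum_congr rfl fun j hj => ?_
  rw [spikedWeight, if_pos (Finset.mem_range.1 hj)]
  split_ifs <;> rfl

/-- With `s = 0` the spike position is immaterial; `spikedWeight N h b 0 0` is the flat reference.
-/
lemma sum_spikedWeight_sub_sq (ha : a < N) :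
    ∑ j ∈ Finset.range N, (spikedWeight N h b s a j - spikedWeight N h b 0 0 j) ^ 2 = s ^ 2 := by
  have : s ^ 2 = (N - 1) * 0 + s ^ 2 := by ring
  rw [this, ← sum_spike ha]
  refine Finset.sum_congr rfl fun j hj => ?_
  simp only [spikedWeight, if_pos (Finset.mem_range.1 hj), add_zero, ite_self]
  split_ifs <;> ring

/-- Column `m + 2` owns exactly `h` pairs, hence `2h` entries of square `1 / (2h)`. -/
lemma two_mul_sum_spikedWeight_sq (hh : 0 < h) (hH : N + h * (d - 2) ≤ H) (ha : a < N)
    (hb : (N - 1) * b ^ 2 + (b + s) ^ 2 = 1 / 2) {k : ℕ} (hk : 1 ≤ k) (hkd : k < d) :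
    2 * ∑ j ∈ Finset.range H, (if blockCol N h j = k then spikedWeight N h b s a j ^ 2 else 0)
      = 1 := by
  rcases hk.eq_or_lt with rfl | hk2
  · rw [sum_blockCol_one (by omega), sum_spikedWeight_sq ha, hb]; norm_num
  obtain ⟨m, rfl⟩ : ∃ m, k = m + 2 := ⟨k - 2, by omega⟩
  have hmul : h * (m + 1) ≤ h * (d - 2) := Nat.mul_le_mul_left h (by omega)
  have hfil : (Finset.range H).filter (fun j => blockCol N h j = m + 2)
      = Finset.Ico (N + h * m) (N + h * (m + 1)) := by
    ext j
    rw [Finset.mem_filter, Finset.mem_range, Finset.mem_Ico, blockCol]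
    constructor
    · rintro ⟨_, hj⟩
      split_ifs at hj with hjN
      · omega
      · have := (Nat.div_eq_iff hh).1 (show (j - N) / h = m by rw [add_comm] at hj; exact Nat.add_right_cancel hj)
        rw [mul_add, mul_one, mul_comm h m]
        omega
    · rintro ⟨hj1, hj2⟩
      have hjN : ¬ j < N := by
        have := Nat.zero_le (h * m); omega
      refine ⟨by omega, ?_⟩
      rw [if_neg hjN, (Nat.div_eq_iff hh).2, add_comm]
      rw [mul_add, mul_one, mul_comm h m] at hj2
      rw [mul_comm h m] at hj1
      omega
  have hh' : (0 : ℝ) < h := by exact_mod_cast hh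
  rw [← Finset.sum_filter, hfil, Finset.sum_congr rfl (g := fun _ => 1 / (2 * (h : ℝ)))]
  · rw [Finset.sum_const, Nat.card_Ico, show N + h * (m + 1) - (N + h * m) = h by
      rw [mul_add]; omega, nsmul_eq_mul]
    field_simp
  · intro j hj
    have : ¬ j < N := by
      have := (Finset.mem_Ico.1 hj).1; have := Nat.zero_le (h * m); omega
    rw [spikedWeight, if_neg this, div_pow, one_pow, Real.sq_sqrt (by positivity)]

lemma spikedWeight_sq_le {B : ℝ} (hb : 0 ≤ b) (hs : 0 ≤ s) (hB : (b + s) ^ 2 ≤ B)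
    (hh : 1 / (2 * (h : ℝ)) ≤ B) (j : ℕ) : spikedWeight N h b s a j ^ 2 ≤ B := by
  unfold spikedWeight
  split_ifs
  · exact hB
  · nlinarith
  · rw [div_pow, one_pow, Real.sq_sqrt (by positivity)]; exact hh

/-- The spike is paid for by lowering the base weight below its flat value `√(1 / (2N))`, so that
the column stays a unit vector; the intermediate value theorem finds `b`. -/
lemma exists_base (hN : 1 ≤ N) (hs0 : 0 ≤ s) (hs : s ^ 2 ≤ 1 / 2) :
    ∃ b : ℝ, 0 ≤ b ∧ b ^ 2 ≤ 1 / (2 * N) ∧ (N - 1) * b ^ 2 + (b + s) ^ 2 = 1 / 2 := by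
  have hN' : (1 : ℝ) ≤ N := by exact_mod_cast hN
  set t : ℝ := √(1 / (2 * N)) with ht
  have ht0 : 0 ≤ t := Real.sqrt_nonneg _
  have ht2 : t ^ 2 = 1 / (2 * N) := Real.sq_sqrt (by positivity)
  have hNt : N * t ^ 2 = 1 / 2 := by rw [ht2]; field_simp
  have hcont : ContinuousOn (fun x : ℝ => (N - 1) * x ^ 2 + (x + s) ^ 2) (Set.Icc 0 t) := by
    fun_prop
  obtain ⟨b, ⟨hb0, hbt⟩, hb⟩ := intermediate_value_Icc ht0 hcont
    (show (1 / 2 : ℝ) ∈ Set.Icc _ _ from ⟨by simpa using hs, by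
      show (1 / 2 : ℝ) ≤ (N - 1) * t ^ 2 + (t + s) ^ 2
      nlinarith [mul_nonneg ht0 hs0, sq_nonneg s]⟩)
  exact ⟨b, hb0, ht2 ▸ pow_le_pow_left₀ hb0 hbt 2, hb⟩

end blocks

/-! ### The spiked hypotheses -/

/-- The separation of two hypotheses. -/
lemma sqrt_add_half_le {x b s : ℝ} (hx : 0 ≤ x) (hb : 0 ≤ b) (hs : 0 ≤ s) (hxb : x ≤ 3 * b ^ 2) :
    √(x + b ^ 2) + s / 2 ≤ √(x + (b + s) ^ 2) := by
  -- This bounds the cross term `s √(x + b²)` by `2bs`.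
  have h1 : √(x + b ^ 2) ≤ 2 * b := Real.sqrt_le_iff.2 ⟨by linarith, by nlinarith⟩
  refine Real.le_sqrt_of_sq_le ?_
  have h2 : √(x + b ^ 2) ^ 2 = x + b ^ 2 := Real.sq_sqrt (by positivity)
  nlinarith

/-- The singular vectors of the network in which the `a`-th pair is raised by `s`. -/
def spikedFrame (n d N h : ℕ) (b s : ℝ) (a : ℕ) : Matrix (Fin n) (Fin d) ℝ :=
  frame n d (blockCol N h) (spikedWeight N h b s a)

/-- The expectation of the network with singular vectors `spikedFrame`. -/
def spikedMean (n p q : ℕ) (kap lam : ℝ) (N h : ℕ) (b s : ℝ) (a : ℕ) : Matrix (Fin n) (Fin n) ℝ :=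
  gram (latent (spikedFrame n (p + q) N h b s a) (spikedSpectrum (p + q) kap lam))

section design

variable {n p q N h : ℕ} {kap lam b s : ℝ}

/-- Entries deviate from `κλ/n ≤ 1/3` by at most three quarters of it, and `7/4 · 1/3 = 7/12`. -/
lemma spikedMean_mem_Icc (hn : 0 < n) (hp : 1 ≤ p) (hk : 0 ≤ kap) (hl : 0 ≤ lam)
    (hkl : 3 * kap * lam ≤ n) (hb : 0 ≤ b) (hs : 0 ≤ s)
    (hbs : (b + s) ^ 2 ≤ 3 / 4 * (kap / n)) (hh : 1 / (2 * (h : ℝ)) ≤ 3 / 4 * (kap / n))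
    (a : ℕ) (i j : Fin n) :
    kap * lam / n / 4 ≤ spikedMean n p q kap lam N h b s a i j ∧
      spikedMean n p q kap lam N h b s a i j ≤ 7 / 12 := by
  have hn0 : (0 : ℝ) < n := by exact_mod_cast hn
  have h1 : |spikedMean n p q kap lam N h b s a i j - kap * lam / n|
      ≤ lam * (3 / 4 * (kap / n)) :=
    abs_gram_frame_sub_le hn hp hk hl (by positivity) (spikedWeight_sq_le hb hs hbs hh) i j
  have h2 : lam * (3 / 4 * (kap / n)) = 3 / 4 * (kap * lam / n) := by ring
  have h3 : kap * lam / n ≤ 1 / 3 := by rw [div_le_iff₀ hn0]; linarith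
  have h4 := abs_le.1 h1
  constructor <;> linarith

lemma sum_sq_spikedMean_sub_le (hd : 2 ≤ p + q) (hk : 0 ≤ kap) (hl : 0 ≤ lam) (hb : 0 ≤ b)
    (hs : 0 ≤ s) (hh : 0 < h) (hH : N + h * (p + q - 2) + 1 ≤ n / 2)
    (hbN : (N - 1) * b ^ 2 + (b + s) ^ 2 = 1 / 2) {a : ℕ} (ha : a < N) :
    ∑ i, ∑ j, (spikedMean n p q kap lam N h b s a i j - spikedMean n p q kap lam N h b 0 0 i j) ^ 2
      ≤ 8 * lam ^ 2 * s ^ 2 := by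
  have hNH : N + 1 ≤ n / 2 := by have := Nat.zero_le (h * (p + q - 2)); omega
  have h1 := sum_sq_gram_frame_sub_le (n := n) (p := p) (q := q) (c := blockCol N h) (kap := kap)
    (lam := lam) (w := spikedWeight N h b s a) (w' := spikedWeight N h b 0 0) hd hk hl
    (le_blockCol hh (by omega) (by omega)) (fun j hj => by
      have : ¬ j < N := fun h => hj (blockCol_eq_one.2 h)
      simp [spikedWeight, this])
  refine h1.trans ?_
  rw [sum_blockCol_one (by omega), sum_blockCol_one (by omega), sum_blockCol_one (by omega),
    sum_spikedWeight_sub_sq ha, sum_spikedWeight_sq ha, sum_spikedWeight_sq (by omega), hbN]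
  -- The reference column has norm at most one, so the bound is `λ² · 2 · 2s² · (1 + 1)`.
  have h2 : (N - 1) * b ^ 2 + (b + 0) ^ 2 ≤ 1 / 2 := by nlinarith
  have h3 : 0 ≤ lam ^ 2 * s ^ 2 := by positivity
  nlinarith

lemma spikedFrame_mem_paramSet (hn : 0 < n) (hp : 1 ≤ p) (hk : 1 ≤ kap) (hl : 0 < lam)
    (hkl : 3 * kap * lam ≤ n) (hb : 0 ≤ b) (hs : 0 ≤ s)
    (hbs : (b + s) ^ 2 ≤ 3 / 4 * (kap / n)) (hhk : 1 / (2 * (h : ℝ)) ≤ 3 / 4 * (kap / n))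
    (hh : 0 < h) (hH : N + h * (p + q - 2) + 1 ≤ n / 2)
    (hbN : (N - 1) * b ^ 2 + (b + s) ^ 2 = 1 / 2) {a : ℕ} (ha : a < N) :
    (spikedFrame n (p + q) N h b s a, spikedSpectrum (p + q) kap lam) ∈
      paramSet n p q kap lam := by
  have hNH : N + 1 ≤ n / 2 := by have := Nat.zero_le (h * (p + q - 2)); omega
  refine ⟨frame_mem_stiefel hn (le_blockCol hh (by omega) (by omega)) fun k hk hkd =>
    two_mul_sum_spikedWeight_sq hh (by omega) ha hbN hk hkd, spikedSpectrum_mem hk hl, ?_⟩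
  intro i j
  obtain ⟨h1, h2⟩ := spikedMean_mem_Icc (q := q) (N := N) hn hp (by linarith) hl.le hkl hb hs
    hbs hhk a i j
  have hk0 : 0 ≤ kap := by linarith
  have h3 : 0 ≤ kap * lam / n / 4 := by positivity
  exact ⟨h3.trans h1, h2.trans (by norm_num)⟩

/-- Compare both losses in row `2a`, which is longer under hypothesis `a` than under `a'`. -/
lemma subspaceLoss_spikedFrame_separated (hd : 2 ≤ p + q) (hNn : 2 * N ≤ n) (hb : 0 ≤ b)
    (hs : 0 ≤ s) (hbn : 1 / (n : ℝ) ≤ 3 * b ^ 2) {a a' : ℕ} (ha : a < N) (haa : a ≠ a')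
    (V : Matrix (Fin n) (Fin (p + q)) ℝ) :
    s / 2 ≤ subspaceLoss V (spikedFrame n (p + q) N h b s a) +
      subspaceLoss V (spikedFrame n (p + q) N h b s a') := by
  have hi : 2 * a < n := by omega
  have h1 := abs_norm_row_sub_le_subspaceLoss V (spikedFrame n (p + q) N h b s a) ⟨2 * a, hi⟩
  have h2 := abs_norm_row_sub_le_subspaceLoss V (spikedFrame n (p + q) N h b s a') ⟨2 * a, hi⟩
  have hca : blockCol N h a = 1 := blockCol_eq_one.2 ha
  rw [spikedFrame, norm_row_frame hd hca hi, ← spikedFrame, spikedWeight, if_pos ha,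
    if_pos rfl] at h1
  rw [spikedFrame, norm_row_frame hd hca hi, ← spikedFrame, spikedWeight, if_pos ha,
    if_neg haa] at h2
  have h3 := sqrt_add_half_le (by positivity : 0 ≤ 1 / (n : ℝ)) hb hs hbn
  have := (abs_le.1 h1).1
  have := (abs_le.1 h2).2
  linarith

/-- The minimax lower bound under explicit conditions on the design. -/
lemma le_subspaceMinimaxRisk_of_design (hn : 400 ≤ n) (hp : 1 ≤ p) (hd : 2 ≤ p + q)
    (hk : 1 ≤ kap) (hl : 0 < lam) (hkl : 3 * kap * lam ≤ n) (hb : 0 ≤ b) (hs : 0 ≤ s)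
    (hbs : (b + s) ^ 2 ≤ 3 / 4 * (kap / n)) (hhk : 1 / (2 * (h : ℝ)) ≤ 3 / 4 * (kap / n))
    (hh : 0 < h) (hH : N + h * (p + q - 2) + 1 ≤ n / 2)
    (hbN : (N - 1) * b ^ 2 + (b + s) ^ 2 = 1 / 2) (hbn : 1 / (n : ℝ) ≤ 3 * b ^ 2)
    (hs2 : s ^ 2 ≤ 1 / 400 * (kap * Real.log n / (lam * n))) (hN : n ≤ 5 * N) :
    ENNReal.ofReal (s / 8) ≤ subspaceMinimaxRisk n p q kap lam := by
  have hn' : (400 : ℝ) ≤ n := by exact_mod_cast hn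
  have hn0 : (0 : ℝ) < n := by linarith
  have hN' : (n : ℝ) ≤ 5 * N := by exact_mod_cast hN
  have hk0 : 0 < kap := by linarith
  have hlog : 0 ≤ Real.log n := Real.log_nonneg (by linarith)
  have hNH : N + 1 ≤ n / 2 := by have := Nat.zero_le (h * (p + q - 2)); omega
  have hbase0 : 0 < kap * lam / n := by positivity
  have hP := fun a i j => spikedMean_mem_Icc (q := q) (N := N) (by omega) hp hk0.le hl.le hkl hb hs
    hbs hhk a i j
  have hP01 : ∀ a i j, 0 ≤ spikedMean n p q kap lam N h b s a i j ∧
      spikedMean n p q kap lam N h b s a i j ≤ 1 := fun a i j => by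
    have := hP a i j; constructor <;> linarith
  have hQ := fun i j => spikedMean_mem_Icc (q := q) (N := N) (by omega) hp hk0.le hl.le hkl hb
    le_rfl (le_trans (by gcongr) hbs) hhk 0 i j
  have hV : ∀ a : Fin N, ∑ ω, edgeMass (spikedMean n p q kap lam N h b s a) ω ^ 2 /
      edgeMass (spikedMean n p q kap lam N h b 0 0) ω ≤ √n := by
    intro a
    refine (sum_edgeMass_sq_div_le _ _ (by positivity) (by norm_num) hQ).trans ?_
    rw [Real.sqrt_eq_rpow, Real.rpow_def_of_pos hn0]
    refine Real.exp_le_exp.2 ?_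
    rw [div_le_iff₀ (by positivity)]
    refine (sum_sq_spikedMean_sub_le hd hk0.le hl.le hb hs hh hH hbN a.2).trans ?_
    -- The target coefficient is `1/2 · 1/4 · 5/12 = 5/96`, which exceeds `1/50`.
    calc 8 * lam ^ 2 * s ^ 2
        ≤ 8 * lam ^ 2 * (1 / 400 * (kap * Real.log n / (lam * n))) := by gcongr
      _ = 1 / 50 * (kap * lam / n * Real.log n) := by field_simp; ring
      _ ≤ _ := by nlinarith [mul_nonneg hbase0.le hlog]
  -- From `√n ≥ 20` follows `4√n ≤ n/5 ≤ N`.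
  have hVM : 4 * √(n : ℝ) ≤ Fintype.card (Fin N) := by
    rw [Fintype.card_fin]
    have h1 : 20 ≤ √(n : ℝ) := Real.le_sqrt_of_sq_le (by norm_num; linarith)
    nlinarith [Real.sq_sqrt hn0.le]
  have : Nonempty (Fin N) := ⟨⟨0, by omega⟩⟩
  refine le_iInf fun est => ?_
  obtain ⟨a, ha⟩ := exists_risk_ge (edgeMass (spikedMean n p q kap lam N h b 0 0))
    (edgeMass_pos fun i j => ⟨lt_of_lt_of_le (by positivity) (hQ i j).1,
      (hQ i j).2.trans_lt (by norm_num)⟩)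
    (sum_edgeMass _) (fun a : Fin N => edgeMass (spikedMean n p q kap lam N h b s a))
    (fun a => edgeMass_nonneg (hP01 a)) (fun a => sum_edgeMass _) (√n) hV hVM
    (fun a ω => subspaceLoss (est (adjacency ω)) (spikedFrame n (p + q) N h b s a))
    (fun _ _ => subspaceLoss_nonneg _ _) (s / 4) (by positivity) (fun a a' haa ω => by
      have := subspaceLoss_spikedFrame_separated (h := h) hd (by omega) hb hs hbn a.2
        (fun h => haa (Fin.ext h)) (est (adjacency ω))
      linarith)
  refine le_iSup₂_of_le (spikedFrame n (p + q) N h b s a, spikedSpectrum (p + q) kap lam)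
    (spikedFrame_mem_paramSet (by omega) hp hk hl hkl hb hs hbs hhk hh hH hbN a.2) ?_
  have hriskEq := lintegral_edgeLaw (hP01 a)
    (fun ω => subspaceLoss (est (adjacency ω)) (spikedFrame n (p + q) N h b s a))
    fun _ => subspaceLoss_nonneg _ _
  refine le_trans (ENNReal.ofReal_le_ofReal ?_) hriskEq.ge
  linarith

end design

/-! ### Choice of the design parameters -/

/-- The minimax lower bound for a fixed number of nodes. -/
theorem le_subspaceMinimaxRisk {n p q : ℕ} {kap lam : ℝ} (hn : 400 ≤ n) (hp : 1 ≤ p)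
    (hd : 2 ≤ p + q) (hl : 0 < lam) (hdk : 3 * ((p + q : ℕ) : ℝ) ≤ kap)
    (hkl : 3 * kap * lam ≤ n) (hkn : kap ≤ n / 24) :
    ENNReal.ofReal (1 / 160 * √(kap * min lam (Real.log n) / (lam * n)))
      ≤ subspaceMinimaxRisk n p q kap lam := by
  have hn' : (400 : ℝ) ≤ n := by exact_mod_cast hn
  have hn0 : (0 : ℝ) < n := by linarith
  have hd' : (2 : ℝ) ≤ ((p + q : ℕ) : ℝ) := by exact_mod_cast hd
  have hk6 : 6 ≤ kap := by linarith
  have hk0 : 0 < kap := by linarith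
  have hlog : 0 ≤ Real.log n := Real.log_nonneg (by linarith)
  have hmin0 : 0 ≤ min lam (Real.log n) := le_min hl.le hlog
  -- The factor `1/20` makes `s²` carry `1/400`; with the risk `s / 8` it yields the constant
  -- `1/160`.
  obtain ⟨s, hs⟩ : ∃ s, s = 1 / 20 * √(kap * min lam (Real.log n) / (lam * n)) := ⟨_, rfl⟩
  have hs0 : 0 ≤ s := by rw [hs]; positivity
  have hs2 : s ^ 2 = 1 / 400 * (kap * min lam (Real.log n) / (lam * n)) := by
    rw [hs, mul_pow, Real.sq_sqrt (by positivity)]; norm_num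
  have hskap : s ^ 2 ≤ 1 / 400 * (kap / n) := by
    rw [hs2]
    refine mul_le_mul_of_nonneg_left ?_ (by norm_num)
    rw [mul_comm lam, ← div_mul_div_comm]
    have := div_le_one_of_le₀ (min_le_left lam (Real.log n)) hl.le
    have h0 : 0 ≤ kap / n := by positivity
    nlinarith
  have hkn' : kap / n ≤ 1 / 24 := by rw [div_le_iff₀ hn0]; linarith
  have hkn6 : 6 / n ≤ kap / n := by gcongr
  obtain ⟨N, hN⟩ : ∃ N, N = n / 4 := ⟨_, rfl⟩
  have hN4 : 4 * N ≤ n := by omega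
  have hN4' : n ≤ 4 * N + 3 := by omega
  have hN1 : 1 ≤ N := by omega
  have hN4r : 4 * (N : ℝ) ≤ n := by exact_mod_cast hN4
  have hN4r' : (n : ℝ) ≤ 4 * N + 3 := by exact_mod_cast hN4'
  have hN0 : (0 : ℝ) < N := by exact_mod_cast hN1
  -- The shortest block with `1 / (2h) ≤ 3κ/(4n)`.
  obtain ⟨h, hhle, hhlt⟩ : ∃ h : ℕ, 2 * n / (3 * kap) ≤ (h : ℝ) ∧ (h : ℝ) < 2 * n / (3 * kap) + 1 :=
    ⟨_, Nat.le_ceil _, Nat.ceil_lt_add_one (by positivity)⟩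
  have hh0r : (0 : ℝ) < h := lt_of_lt_of_le (by positivity) hhle
  have hh0 : 0 < h := by exact_mod_cast hh0r
  have hH : N + h * (p + q - 2) + 1 ≤ n / 2 := by
    rw [Nat.le_div_iff_mul_le two_pos]
    have hcast : ((p + q - 2 : ℕ) : ℝ) ≤ kap / 3 := by
      rw [Nat.cast_sub hd]; push_cast at hdk ⊢; linarith
    have h1 : (h : ℝ) * ((p + q - 2 : ℕ) : ℝ) ≤ (2 * n / (3 * kap) + 1) * (kap / 3) :=
      mul_le_mul hhlt.le hcast (Nat.cast_nonneg _) (by positivity)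
    have h2 : (2 * n / (3 * kap) + 1) * (kap / 3) = 2 / 9 * n + kap / 3 := by
      field_simp; ring
    -- The shares `n/4`, `2n/9` and `κ/3 ≤ n/72` add up to `35n/72`, leaving room for one spare
    -- pair.
    have h3 : (((N + h * (p + q - 2) + 1) * 2 : ℕ) : ℝ) ≤ n := by
      push_cast; linarith
    exact_mod_cast h3
  obtain ⟨b, hb0, hb2, hbN⟩ := exists_base (s := s) hN1 hs0 (by linarith)
  have hb2' : b ^ 2 ≤ 5 / 12 * (kap / n) := by
    have : 1 / (2 * (N : ℝ)) ≤ 5 / 12 * (6 / n) := by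
      rw [← mul_div_assoc, div_le_div_iff₀ (by positivity) hn0]; linarith
    linarith
  -- Uses `2bs ≤ b²/4 + 4s²`.
  have hbs : (b + s) ^ 2 ≤ 3 / 4 * (kap / n) := by nlinarith [sq_nonneg (b / 2 - 2 * s)]
  have hhB : 1 / (2 * (h : ℝ)) ≤ 3 / 4 * (kap / n) := by
    have : 1 / (2 * (h : ℝ)) ≤ 1 / (2 * (2 * n / (3 * kap))) := by gcongr
    refine this.trans (le_of_eq ?_)
    field_simp; norm_num
  have hbn : 1 / (n : ℝ) ≤ 3 * b ^ 2 := by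
    rw [div_le_iff₀ hn0]
    have h1 : (b + s) ^ 2 ≤ 2 * b ^ 2 + 2 * s ^ 2 := by nlinarith [sq_nonneg (b - s)]
    have h2 : (N + 1) * b ^ 2 ≥ 1 / 2 - 2 * s ^ 2 := by linarith
    nlinarith [sq_nonneg b]
  have hs2' : s ^ 2 ≤ 1 / 400 * (kap * Real.log n / (lam * n)) := by
    rw [hs2]
    gcongr
    exact min_le_right _ _
  refine le_trans (le_of_eq ?_) (le_subspaceMinimaxRisk_of_design hn hp hd (by linarith) hl hkl hb0
    hs0 hbs hhB hh0 hH hbN hbn hs2' (by omega))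
  rw [hs]
  congr 1
  ring

end LowRankNetwork

end

theorem corollary2 :
    ∃ c : ℝ, 0 < c ∧
      ∀ (p q : ℕ → ℕ) (kappaStar lamStar : ℕ → ℝ),
        (∀ᶠ n in atTop, 1 ≤ p n) →
        (∀ᶠ n in atTop, 2 ≤ p n + q n) →
        (∀ᶠ n in atTop, 0 < lamStar n) →
        (kappaStar =o[atTop] fun n => (n : ℝ)) →
        (∀ᶠ n in atTop, 3 * ((p n + q n : ℕ) : ℝ) ≤ kappaStar n) →
        (∀ᶠ n in atTop, 3 * kappaStar n * lamStar n ≤ (n : ℝ)) →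
        ∀ᶠ n in atTop,
          ENNReal.ofReal
              (c * √(kappaStar n * min (lamStar n) (Real.log n) / (lamStar n * n))) ≤
            LowRankNetwork.subspaceMinimaxRisk n (p n) (q n) (kappaStar n) (lamStar n) := by
  refine ⟨1 / 160, by norm_num, fun p q kap lam hp hd hl ho hdk hkl => ?_⟩
  filter_upwards [hp, hd, hl, hdk, hkl, ho.bound (show (0 : ℝ) < 1 / 24 by norm_num),
    eventually_ge_atTop 400] with n hp hd hl hdk hkl ho hn
  refine LowRankNetwork.le_subspaceMinimaxRisk hn hp hd hl hdk hkl ?_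
  rw [Real.norm_eq_abs, Real.norm_eq_abs, abs_of_nonneg (Nat.cast_nonneg n : (0 : ℝ) ≤ n)] at ho
  linarith [le_abs_self (kap n)]
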